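/- Let $n,k$ be integers with $1\le k\le n-1$, write $[n]=\{1,\dots,n\}$, and for $S\subseteq[n]$ let $e_j(S)=\sum_{T\subseteq S,\,|T|=j}\prod_{i\in T}x_i$, $e_j(\mathbf x)=e_j([n])$, and $q_j(S)=e_j(S)/e_{j-1}(S)$ for $j\ge1$. Let $G_{n,k}$ be the graph whose vertices are two distinguished vertices $s$ and $z$ together with all words $w_1\cdots w_\ell$, $1\le \ell\le k$, with pairwise distinct letters $w_i\in[n]$; its edges join (1) $s$ and each one-letter word $i\in[n]$, (2) $w_1\cdots w_{i-1}$ and $w_1\cdots w_{i-1}w_i$ for $2\le i\le k$, (3) $w_1\cdots w_k$ and $z$. Let $T_{G_{n,k}}=\sum_T\prod_{e\in T}x_e$ be its spanning tree polynomial, the sum being over all spanning trees $T$ (as sets of edges) of $G_{n,k}$. For $r\ge k$ let $H_{k,r}(\mathbf x)\in\mathbb R(x_1,\dots,x_n)$ be obtained from $T_{G_{n,k}}$ by substituting for the edge variables: $r!\,x_i$ for the edges (1), $(r-i+1)!\,x_{w_i}$ for the edges (2), and $(r-k+1)!\,q_{r-k+1}([n]\setminus\{w_1,\dots,w_k\})$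 for the edges (3). Then for $r=k$ every substituted value is a linear form in $x_1,\dots,x_n$, so that the polynomial $H_{k,k}(\mathbf x)$ is obtained from $T_{G_{n,k}}$ by a linear substitution of the edge variables, and there is a constant $C_k>0$ (which may depend on $n$ and $k$) such that $$H_{k,k}(\mathbf x)=C_k\,e_{k+1}(\mathbf x)\prod_{S\subseteq[n],\ |S|\le k-1}\bigl(\partial^S e_k(\mathbf x)\bigr)^{|S|!\,(n-|S|-1)},\qquad \partial^S=\prod_{j\in S}\frac{\partial}{\partial x_j}.$$ -/

import Mathlib

open scoped Nat

noncomputable section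

/-- The spanning tree polynomial of a finite graph `G`: one variable for every edge, and the sum of
the monomials `∏ e ∈ T, x_e` over all sets `T` of edges of `G` that form a spanning tree. -/
def spanningTreePolynomial {V : Type*} [Fintype V] (G : SimpleGraph V) :
    MvPolynomial G.edgeSet ℝ := by
  classical
  exact ∑ T : Finset G.edgeSet with
      (SimpleGraph.fromEdgeSet (Subtype.val '' (T : Set G.edgeSet))).IsTree,
    ∏ e ∈ T, MvPolynomial.X e

/-- Words of length at most `k` with pairwise distinct letters in `[n]`.
The alphabet `[n]` is represented by `Fin n`. -/
abbrev DWord (n k : ℕ) : Type := {w : List (Fin n) // w.Nodup ∧ w.length ≤ k}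

/-- The vertices of `G_{n,k}`. The vertex `z` is `none`. The vertex `s` is the empty word, and the
other vertices are the nonempty words of length at most `k` without repeated letters. -/
abbrev GVertex (n k : ℕ) : Type := Option (DWord n k)

instance (n k : ℕ) : Fintype (DWord n k) :=
  haveI : Finite (DWord n k) :=
    Finite.of_injective (β := {w : List (Fin n) // w.Nodup}) (fun w => ⟨w.1, w.2.1⟩)
      (fun _ _ h => Subtype.ext (congrArg (fun t => t.1) h))
  Fintype.ofFinite _

/-- Adjacency in `G_{n,k}`: each word (`s` being the empty one) is joined to its extensions by one
letter, and each word of length exactly `k` is joined to `z`. -/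
def GAdj (n k : ℕ) : GVertex n k → GVertex n k → Prop
  | none, none => False
  | none, some w => w.1.length = k
  | some w, none => w.1.length = k
  | some u, some v => (∃ a, v.1 = u.1 ++ [a]) ∨ (∃ a, u.1 = v.1 ++ [a])

/-- The graph `G_{n,k}`. -/
def GGraph (n k : ℕ) : SimpleGraph (GVertex n k) where
  Adj := GAdj n k
  symm := ⟨by
    rintro (_ | u) (_ | v) h
    · exact h
    · exact h
    · exact h
    · exact Or.symm h⟩
  loopless := ⟨by
    rintro (_ | u) h
    · exact h
    · rcases h with ⟨a, h⟩ | ⟨a, h⟩ <;> simp at h⟩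

/-- The field `ℝ(x_1, …, x_n)` of rational functions. -/
abbrev RatFun (n : ℕ) : Type := FractionRing (MvPolynomial (Fin n) ℝ)

/-- The elementary symmetric polynomial `e_j(S)` in the variables with index in `S`. -/
def esymmOn {n : ℕ} (j : ℕ) (S : Finset (Fin n)) : MvPolynomial (Fin n) ℝ :=
  ∑ T ∈ S.powersetCard j, ∏ i ∈ T, MvPolynomial.X i

/-- The rational function `q_j(S) = e_j(S) / e_{j-1}(S)`, for `j ≥ 1`. -/
def qRat {n : ℕ} (j : ℕ) (S : Finset (Fin n)) : RatFun n :=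
  algebraMap (MvPolynomial (Fin n) ℝ) (RatFun n) (esymmOn j S) /
    algebraMap (MvPolynomial (Fin n) ℝ) (RatFun n) (esymmOn (j - 1) S)

/-- The value `(r - i + 1)! x_{w_i}` for the edge between `w_1 ⋯ w_{i-1}` and
`w = w_1 ⋯ w_i`, where `i ≥ 1`. -/
def letterVar {n : ℕ} (r : ℕ) (w : List (Fin n)) : RatFun n :=
  match w.getLast? with
  | none => 0
  | some a => ((r - w.length + 1)! : RatFun n) *
      algebraMap (MvPolynomial (Fin n) ℝ) (RatFun n) (MvPolynomial.X a)

/-- The value `(r - k + 1)! q_{r-k+1}([n] \ {w_1, …, w_k})` for the edge between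
`w = w_1 ⋯ w_k` and `z`. -/
def terminalVar {n : ℕ} (k r : ℕ) (w : List (Fin n)) : RatFun n :=
  ((r - k + 1)! : RatFun n) * qRat (r - k + 1) (w.toFinset)ᶜ

/-- The value given to the variable of the edge with end points `u` and `v`. For an edge between
two words, it is read off from the longer one. Only the values at edges of `G_{n,k}` matter. -/
def endpointVar (n k r : ℕ) : GVertex n k → GVertex n k → RatFun n
  | none, none => 0
  | none, some w => terminalVar k r w.1
  | some w, none => terminalVar k r w.1
  | some u, some v =>
      if u.1.length < v.1.length then letterVar r v.1
      else if v.1.length < u.1.length then letterVar r u.1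
      else 0

theorem endpointVar_comm (n k r : ℕ) (u v : GVertex n k) :
    endpointVar n k r u v = endpointVar n k r v u := by
  rcases u with _ | u <;> rcases v with _ | v <;> simp only [endpointVar]
  split_ifs <;> first | rfl | omega

/-- The value given to the variable of an edge of `G_{n,k}` in the definition of `H_{k,r}`. -/
def edgeValue (n k r : ℕ) (e : (GGraph n k).edgeSet) : RatFun n :=
  Sym2.lift ⟨endpointVar n k r, endpointVar_comm n k r⟩ e.1

/-- The rational function `H_{k,r}`, for `k ≤ r`: the spanning tree polynomial of `G_{n,k}`
with `edgeValue n k r e` substituted for the variable of each edge `e`. -/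
def HRat (n k r : ℕ) : RatFun n :=
  MvPolynomial.aeval (edgeValue n k r) (spanningTreePolynomial (GGraph n k))

theorem pderiv_toLinearMap_commute {n : ℕ} (i j : Fin n) :
    Commute ((MvPolynomial.pderiv i : Derivation ℝ (MvPolynomial (Fin n) ℝ) _) :
        Module.End ℝ (MvPolynomial (Fin n) ℝ))
      ((MvPolynomial.pderiv j : Derivation ℝ (MvPolynomial (Fin n) ℝ) _) :
        Module.End ℝ (MvPolynomial (Fin n) ℝ)) := by
  have h : ⁅(MvPolynomial.pderiv i : Derivation ℝ (MvPolynomial (Fin n) ℝ) _),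
      (MvPolynomial.pderiv j : Derivation ℝ (MvPolynomial (Fin n) ℝ) _)⁆ = 0 := by
    apply MvPolynomial.derivation_ext
    intro l
    rw [Derivation.commutator_apply]
    simp only [MvPolynomial.pderiv_X, Derivation.coe_zero, Pi.zero_apply]
    by_cases hi : i = l <;> by_cases hj : j = l <;> simp [hi, hj, eq_comm]
  refine LinearMap.ext fun p => ?_
  have h2 := congrArg (fun D => D p) h
  simp only [Derivation.commutator_apply, Derivation.coe_zero, Pi.zero_apply] at h2
  exact sub_eq_zero.mp h2

/-- The differential operator `∂^S = ∏_{j ∈ S} ∂/∂x_j`. -/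
def partialSet {n : ℕ} (S : Finset (Fin n)) : Module.End ℝ (MvPolynomial (Fin n) ℝ) :=
  S.noncommProd (fun j => ((MvPolynomial.pderiv j : Derivation ℝ (MvPolynomial (Fin n) ℝ) _) :
    Module.End ℝ (MvPolynomial (Fin n) ℝ))) (fun i _ j _ _ => pderiv_toLinearMap_commute i j)

end

/-! ### The matrix-tree theorem with root `none`. -/

section MatrixTree

variable {W : Type*} [Fintype W] [DecidableEq W] {K : Type*} [Field K]

/-! Read the edge values as conductances. Deleting z from G_{n,k} leaves a tree of words rooted at
s, so the Laplacian with z grounded can be eliminated from the leaves upwards without fill-in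
(`det_reducedLaplacian_of_forest`); by the matrix-tree theorem H_{k,k} is the product of the pivots.
The pivot at v is D_v = x_v + c_v, where x_v is the value of the edge to the parent and c_v the
effective conductance from v to z below v, so that c_u = ∑ x_v c_v / D_v over the children v of an
inner word u. The solution is c_v = (k-|v|+1)! q_{k-|v|+1}([n] \ v): with S = [n] \ u, the identity
e_m(S) = e_m(S \ a) + x_a e_{m-1}(S \ a) gives the pivots, and ∑_{a ∈ S} x_a e_m(S \ a) = (m+1)
e_{m+1}(S) sums the children (`conductance_eq_sum`). Up to a factorial, D_v = e_{k-|u|}([n] \ u) /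
e_{k-|v|}([n] \ v) for v with parent u. In the product, the factor of an inner word u occurs n-|u|
times in numerators and once in a denominator. The |S|! orderings of S give the exponent, the root
leaves e_{k+1}, and ∂^S e_k = e_{k-|S|}([n] \ S) (`prod_pivot`, `partialSet_esymm`). -/

theorem Matrix.det_eq_one_of_rank (M : Matrix W W K) (d : W → ℕ) (hdiag : ∀ v, M v v = 1)
    (h : ∀ u v, u ≠ v → M u v ≠ 0 → d v < d u) : M.det = 1 := by
  have hM : M.BlockTriangular (OrderDual.toDual ∘ d) := by
    intro i j hij
    by_contra hne
    have hij' : d i < d j := hij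
    have := h i j (by rintro rfl; exact lt_irrefl _ hij') hne
    omega
  rw [hM.det]
  refine Finset.prod_eq_one fun a _ => ?_
  have : M.toSquareBlock (OrderDual.toDual ∘ d) a = 1 := by
    ext i j
    by_cases hij : i = j
    · subst hij
      simp [Matrix.toSquareBlock_def, hdiag]
    · rw [Matrix.one_apply_ne hij, Matrix.toSquareBlock_def, Matrix.of_apply]
      by_contra hne
      have := h i j (fun e => hij (Subtype.ext e)) hne
      have hi : d i = d j := by
        have h1 : OrderDual.toDual (d i) = a := i.2
        have h2 : OrderDual.toDual (d j) = a := j.2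
        exact OrderDual.toDual.injective (h1.trans h2.symm)
      omega
  rw [this, Matrix.det_one]

/-- The weighted Laplacian of a graph on `Option W`, with the row and column of `none` removed. -/
def reducedLaplacian (w : W → Option W → K) : Matrix W W K :=
  Matrix.of fun v u => (if v = u then ∑ o, w v o else 0) - w v (some u)

/-- The reduced Laplacian of the functional digraph `v ⟶ f v`. -/
def parentMatrix (K : Type*) [Field K] (f : W → Option W) : Matrix W W K :=
  Matrix.of fun v u => (if v = u then 1 else 0) - (if f v = some u then 1 else 0)

/-- Row v is the sum over o of w v o times the row of the single arc v ⟶ o; multilinearity in the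
rows selects one arc out of every vertex. -/
theorem det_reducedLaplacian_eq_sum (w : W → Option W → K) :
    (reducedLaplacian w).det =
      ∑ f : W → Option W, (∏ v, w v (f v)) * (parentMatrix K f).det := by
  have hrow : reducedLaplacian w = fun v => ∑ o : Option W, w v o •
      (fun u => (if v = u then 1 else 0) - (if o = some u then 1 else 0) : W → K) := by
    funext v u
    simp only [reducedLaplacian, Matrix.of_apply, Finset.sum_apply, Pi.smul_apply, smul_eq_mul,
      mul_sub, Finset.sum_sub_distrib]
    congr 1
    · split_ifs <;> simp
    · simp
  have h := (Matrix.detRowAlternating (n := W) (R := K)).toMultilinearMap.map_sum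
    (fun (v : W) (o : Option W) => w v o •
      (fun u => (if v = u then 1 else 0) - (if o = some u then 1 else 0) : W → K))
  rw [hrow]
  refine h.trans (Finset.sum_congr rfl fun f _ => ?_)
  rw [MultilinearMap.map_smul_univ, smul_eq_mul]
  rfl

/-- Iterating `f` from `v` ends at `none`. -/
def ReachesRoot (f : W → Option W) (v : W) : Prop :=
  ∃ m : ℕ, (fun o : Option W => o.bind f)^[m] (some v) = none

omit [Fintype W] [DecidableEq W] in
theorem reachesRoot_of_eq_none {f : W → Option W} {v : W} (h : f v = none) : ReachesRoot f v :=
  ⟨1, by simpa using h⟩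

omit [Fintype W] [DecidableEq W] in
theorem reachesRoot_iff_of_eq_some {f : W → Option W} {v u : W} (h : f v = some u) :
    ReachesRoot f v ↔ ReachesRoot f u := by
  constructor
  · rintro ⟨_ | m, hm⟩
    · simp at hm
    · exact ⟨m, by simpa [h] using hm⟩
  · rintro ⟨m, hm⟩
    exact ⟨m + 1, by simpa [h] using hm⟩

omit [Fintype W] [DecidableEq W] in
theorem exists_rank_of_reachesRoot {f : W → Option W} (hf : ∀ v, ReachesRoot f v) :
    ∃ d : W → ℕ, ∀ v u, f v = some u → d u < d v := by
  classical
  have hf' : ∀ v, ∃ m : ℕ, (fun o : Option W => o.bind f)^[m] (some v) = none := hf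
  refine ⟨fun v => Nat.find (hf' v), fun v u h => ?_⟩
  have hs := Nat.find_spec (hf' v)
  rcases hm : Nat.find (hf' v) with _ | m
  · rw [hm] at hs
    simp at hs
  · dsimp only
    rw [hm] at hs ⊢
    refine Nat.lt_succ_of_le (Nat.find_min' _ ?_)
    simpa [h] using hs

omit [Fintype W] [DecidableEq W] in
theorem reachesRoot_of_rank {f : W → Option W} (d : W → ℕ)
    (hd : ∀ v u, f v = some u → d u < d v) (v : W) : ReachesRoot f v := by
  induction h : d v using Nat.strong_induction_on generalizing v with
  | _ m ih =>
    rcases hv : f v with _ | u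
    · exact reachesRoot_of_eq_none hv
    · rw [reachesRoot_iff_of_eq_some hv]
      exact ih _ (h ▸ hd v u hv) u rfl

theorem det_parentMatrix_of_reachesRoot {f : W → Option W} (hf : ∀ v, ReachesRoot f v) :
    (parentMatrix K f).det = 1 := by
  obtain ⟨d, hd⟩ := exists_rank_of_reachesRoot hf
  refine Matrix.det_eq_one_of_rank _ d (fun v => ?_) fun u v huv hne => ?_
  · have : f v ≠ some v := fun h => lt_irrefl _ (hd v v h)
    simp [parentMatrix, this]
  · refine hd u v ?_
    by_contra hfu
    simp [parentMatrix, huv, hfu] at hne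

theorem det_parentMatrix_of_not_reachesRoot {f : W → Option W} (hf : ¬ ∀ v, ReachesRoot f v) :
    (parentMatrix K f).det = 0 := by
  classical
  push Not at hf
  obtain ⟨v₀, hv₀⟩ := hf
  rw [← Matrix.exists_mulVec_eq_zero_iff]
  -- The indicator of the vertices that never reach the root is a kernel vector, since v and f v are
  -- of the same kind.
  refine ⟨fun v => if ReachesRoot f v then 0 else 1, fun h => ?_, ?_⟩
  · simpa [hv₀] using congrFun h v₀
  · funext v
    simp only [Matrix.mulVec, dotProduct, parentMatrix, Matrix.of_apply, sub_mul,
      Finset.sum_sub_distrib, ite_mul, one_mul, zero_mul, Finset.sum_ite_eq, Finset.mem_univ,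
      if_true, Pi.zero_apply]
    rcases hv : f v with _ | u
    · simp [reachesRoot_of_eq_none hv]
    · simp [reachesRoot_iff_of_eq_some hv]

-- A rooted tree has only one orientation towards its root. At a disagreement, f v = some u and g u
-- = some v; induction on the rank gives f u = g u, hence a 2-cycle of f.
omit [Fintype W] [DecidableEq W] in
theorem eq_of_edges_eq {f g : W → Option W} (hf : ∀ v, ReachesRoot f v)
    (h : ∀ v, ∃ u, s(some v, f v) = s(some u, g u)) : f = g := by
  obtain ⟨d, hd⟩ := exists_rank_of_reachesRoot hf
  have hstep : ∀ v, f v ≠ g v → ∃ u, f v = some u ∧ g u = some v := by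
    intro v hne
    obtain ⟨u, hu⟩ := h v
    rcases Sym2.eq_iff.1 hu with ⟨h1, h2⟩ | ⟨h1, h2⟩
    · obtain rfl := Option.some.inj h1
      exact absurd h2 hne
    · exact ⟨u, h2, h1.symm⟩
  funext v
  induction hm : d v using Nat.strong_induction_on generalizing v with
  | _ m ih =>
    by_contra hne
    obtain ⟨u, hu, hgu⟩ := hstep v hne
    have hlt := hd v u hu
    have hfu := (ih _ (hm ▸ hlt) u rfl).trans hgu
    have := hd u v hfu
    omega

omit [Fintype W] [DecidableEq W] in
theorem edge_injective {f : W → Option W} (hf : ∀ v, ReachesRoot f v) :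
    Function.Injective fun v => s(some v, f v) := by
  obtain ⟨d, hd⟩ := exists_rank_of_reachesRoot hf
  intro v u h
  rcases Sym2.eq_iff.1 h with ⟨h1, _⟩ | ⟨h1, h2⟩
  · exact Option.some.inj h1
  · have := hd _ _ h2
    have := hd _ _ h1.symm
    omega

omit [DecidableEq W] in
theorem isTree_of_reachesRoot {f : W → Option W} (hf : ∀ v, ReachesRoot f v) :
    (SimpleGraph.fromEdgeSet (Set.range fun v => s(some v, f v))).IsTree := by
  obtain ⟨d, hd⟩ := exists_rank_of_reachesRoot hf
  have hne : ∀ v, some v ≠ f v := fun v h => lt_irrefl _ (hd v v h.symm)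
  rw [SimpleGraph.isTree_iff_connected_and_card]
  constructor
  · have hreach : ∀ v, (SimpleGraph.fromEdgeSet (Set.range fun v => s(some v, f v))).Reachable
        (some v) none := by
      intro v
      induction hm : d v using Nat.strong_induction_on generalizing v with
      | _ m ih =>
        have hadj : (SimpleGraph.fromEdgeSet (Set.range fun v => s(some v, f v))).Adj
            (some v) (f v) := (SimpleGraph.fromEdgeSet_adj _).2 ⟨⟨v, rfl⟩, hne v⟩
        rcases hv : f v with _ | u
        · rw [hv] at hadj
          exact hadj.reachable
        · rw [hv] at hadj
          exact hadj.reachable.trans (ih _ (hm ▸ hd v u hv) u rfl)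
    have hroot : ∀ o, (SimpleGraph.fromEdgeSet (Set.range fun v => s(some v, f v))).Reachable
        o none := by
      rintro (_ | v)
      · exact SimpleGraph.Reachable.refl _
      · exact hreach v
    exact ⟨fun a b => (hroot a).trans (hroot b).symm⟩
  · rw [SimpleGraph.edgeSet_fromEdgeSet]
    have : (Set.range fun v => s(some v, f v)) \ Sym2.diagSet =
        Set.range fun v => s(some v, f v) := by
      refine sdiff_eq_left.2 (Set.disjoint_left.2 ?_)
      rintro _ ⟨v, rfl⟩ h
      exact hne v (Sym2.mk_isDiag_iff.1 h)
    have h2 : Nat.card (Set.range fun v => s(some v, f v)) = Nat.card W :=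
      Nat.card_range_of_injective (edge_injective hf)
    simp only [this, h2, Finite.card_option]

-- Each vertex is sent to a neighbour closer to the root. These edges are distinct and as numerous
-- as the edges of the tree, so they are all of them.
omit [DecidableEq W] in
theorem exists_reachesRoot_of_isTree {H : SimpleGraph (Option W)} (hH : H.IsTree) :
    ∃ f : W → Option W, (∀ v, ReachesRoot f v) ∧ H.edgeSet = Set.range fun v => s(some v, f v) := by
  have hex : ∀ v : W, ∃ o, H.Adj (some v) o ∧ H.dist o none < H.dist (some v) none := by
    intro v
    obtain ⟨p, hp⟩ := hH.connected.exists_walk_length_eq_dist (some v) none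
    cases p with
    | cons h q =>
      refine ⟨_, h, ?_⟩
      rw [← hp, SimpleGraph.Walk.length_cons]
      exact Nat.lt_succ_of_le (SimpleGraph.dist_le q)
  choose f hadj hdist using hex
  have hf : ∀ v, ReachesRoot f v := reachesRoot_of_rank (fun v => H.dist (some v) none)
    fun v u h => h ▸ hdist v
  refine ⟨f, hf, ?_⟩
  have hsub : (Set.range fun v => s(some v, f v)) ⊆ H.edgeSet := by
    rintro _ ⟨v, rfl⟩
    exact hadj v
  refine (Set.eq_of_subset_of_ncard_le hsub ?_ (Set.toFinite _)).symm
  have hc := (SimpleGraph.isTree_iff_connected_and_card.1 hH).2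
  have h2 : Nat.card (Set.range fun v => s(some v, f v)) = Nat.card W :=
    Nat.card_range_of_injective (edge_injective hf)
  rw [Finite.card_option, Nat.add_right_cancel_iff] at hc
  rw [← Nat.card_coe_set_eq, ← Nat.card_coe_set_eq, hc, h2]

-- The sum in the definition is indexed by `Set`s coerced from finsets of edges; here the index
-- becomes the finset itself.
open Classical in
theorem spanningTreePolynomial_eq_sum_finset {V : Type*} [Fintype V] (G : SimpleGraph V) :
    spanningTreePolynomial G = ∑ T ∈ (Finset.univ : Finset (Finset G.edgeSet)).filter
        (fun T : Finset G.edgeSet =>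
          (SimpleGraph.fromEdgeSet (Subtype.val '' (T : Set G.edgeSet))).IsTree),
      ∏ e ∈ T, MvPolynomial.X e := by
  unfold spanningTreePolynomial
  symm
  refine Finset.sum_bij (fun T _ => (T : Set G.edgeSet)) ?_ ?_ ?_ ?_
  · intro T hT
    refine Finset.mem_filter.2 ⟨?_, (Finset.mem_filter.1 hT).2⟩
    simp only [Finset.bind_def]
    exact Finset.mem_sup.2 ⟨T, Finset.mem_univ _, Finset.mem_singleton_self _⟩
  · intro T _ T' _ h
    exact Finset.coe_injective h
  · intro T hT
    refine ⟨T.toFinset, Finset.mem_filter.2 ⟨Finset.mem_univ _, ?_⟩, Set.coe_toFinset T⟩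
    rw [Set.coe_toFinset]
    exact (Finset.mem_filter.1 hT).2
  · intro T _
    rw [Finset.toFinset_coe]

omit [DecidableEq W] in
theorem coe_image_edges {G : SimpleGraph (Option W)}
    {f : W → Option W} (h : ∀ v, G.Adj (some v) (f v)) [DecidableEq G.edgeSet] :
    Subtype.val '' ((Finset.univ.image fun v => (⟨s(some v, f v), h v⟩ : G.edgeSet) :
      Finset G.edgeSet) : Set G.edgeSet) = Set.range fun v => s(some v, f v) := by
  rw [Finset.coe_image, Finset.coe_univ, Set.image_univ, ← Set.range_comp]
  rfl

/-- **Matrix-tree theorem**, for a graph whose root is `none`. -/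
theorem aeval_spanningTreePolynomial_eq_det [Algebra ℝ K] (G : SimpleGraph (Option W))
    (x : G.edgeSet → K) (w : W → Option W → K)
    (hw : ∀ v o (h : G.Adj (some v) o), w v o = x ⟨s(some v, o), h⟩)
    (hw0 : ∀ v o, ¬ G.Adj (some v) o → w v o = 0) :
    MvPolynomial.aeval x (spanningTreePolynomial G) = (reducedLaplacian w).det := by
  classical
  rw [det_reducedLaplacian_eq_sum]
  -- A parent function that uses a non-edge has weight 0, and one that misses the root has
  -- determinant 0.
  have hfilter : ∑ f : W → Option W, (∏ v, w v (f v)) * (parentMatrix K f).det =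
      ∑ f : W → Option W with (∀ v, ReachesRoot f v) ∧ ∀ v, G.Adj (some v) (f v),
        ∏ v, w v (f v) := by
    rw [Finset.sum_filter]
    refine Finset.sum_congr rfl fun f _ => ?_
    split_ifs with h
    · rw [det_parentMatrix_of_reachesRoot h.1, mul_one]
    · by_cases h1 : ∀ v, ReachesRoot f v
      · have h2 : ¬ ∀ v, G.Adj (some v) (f v) := fun h2 => h ⟨h1, h2⟩
        push Not at h2
        obtain ⟨v, hv⟩ := h2
        rw [Finset.prod_eq_zero (Finset.mem_univ v) (hw0 _ _ hv), zero_mul]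
      · rw [det_parentMatrix_of_not_reachesRoot h1, mul_zero]
  rw [hfilter]
  simp only [spanningTreePolynomial_eq_sum_finset, map_sum, map_prod, MvPolynomial.aeval_X]
  symm
  refine Finset.sum_bij
    (fun f hf => Finset.univ.image fun v =>
      (⟨s(some v, f v), (Finset.mem_filter.1 hf).2.2 v⟩ : G.edgeSet)) ?_ ?_ ?_ ?_
  · intro f hf
    have hf' := (Finset.mem_filter.1 hf).2
    refine Finset.mem_filter.2 ⟨Finset.mem_univ _, ?_⟩
    have h := isTree_of_reachesRoot hf'.1
    rw [← coe_image_edges hf'.2] at h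
    exact h
  · intro f hf g hg hfg
    refine eq_of_edges_eq (Finset.mem_filter.1 hf).2.1 fun v => ?_
    have hmem : (⟨s(some v, f v), (Finset.mem_filter.1 hf).2.2 v⟩ : G.edgeSet) ∈
        Finset.univ.image fun v =>
          (⟨s(some v, g v), (Finset.mem_filter.1 hg).2.2 v⟩ : G.edgeSet) :=
      hfg ▸ Finset.mem_image_of_mem _ (Finset.mem_univ v)
    obtain ⟨u, -, hu⟩ := Finset.mem_image.1 hmem
    exact ⟨u, (congrArg Subtype.val hu).symm⟩
  · intro T hT
    obtain ⟨f, hf, hfT⟩ := exists_reachesRoot_of_isTree (Finset.mem_filter.1 hT).2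
    have hTf : Subtype.val '' (T : Set G.edgeSet) = Set.range fun v => s(some v, f v) := by
      rw [← hfT, SimpleGraph.edgeSet_fromEdgeSet]
      refine (sdiff_eq_left.2 (Set.disjoint_left.2 ?_)).symm
      rintro _ ⟨e, _, rfl⟩ h
      exact G.not_isDiag_of_mem_edgeSet e.2 h
    have hadj : ∀ v, G.Adj (some v) (f v) := fun v => by
      have : s(some v, f v) ∈ Subtype.val '' (T : Set G.edgeSet) := hTf ▸ ⟨v, rfl⟩
      obtain ⟨e, -, he⟩ := this
      have := e.2
      rwa [he] at this
    refine ⟨f, Finset.mem_filter.2 ⟨Finset.mem_univ _, hf, hadj⟩, ?_⟩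
    apply Finset.coe_injective
    apply Set.image_injective.2 Subtype.val_injective
    rw [hTf, coe_image_edges hadj]
  · intro f hf
    have hf' := (Finset.mem_filter.1 hf).2
    rw [Finset.prod_image fun u _ v _ h => edge_injective hf'.1 (congrArg Subtype.val h)]
    exact Finset.prod_congr rfl fun v _ => hw _ _ _

end MatrixTree

/-! ### Identities for elementary symmetric polynomials. -/

section ElementarySymmetric

variable {n : ℕ}

@[simp] theorem esymmOn_zero (S : Finset (Fin n)) : esymmOn 0 S = 1 := by
  simp [esymmOn]

theorem esymmOn_univ (j : ℕ) :
    esymmOn j (Finset.univ : Finset (Fin n)) = MvPolynomial.esymm (Fin n) ℝ j := rfl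

theorem esymmOn_one (S : Finset (Fin n)) : esymmOn 1 S = ∑ i ∈ S, MvPolynomial.X i := by
  simp [esymmOn, Finset.powersetCard_one]

theorem esymmOn_succ_insert (m : ℕ) {S : Finset (Fin n)} {j : Fin n} (hj : j ∉ S) :
    esymmOn (m + 1) (insert j S) = esymmOn (m + 1) S + MvPolynomial.X j * esymmOn m S := by
  have hnot : ∀ T ∈ S.powersetCard m, j ∉ T := fun T hT h =>
    hj ((Finset.mem_powersetCard.1 hT).1 h)
  unfold esymmOn
  rw [Finset.powersetCard_succ_insert hj, Finset.sum_union, Finset.sum_image, Finset.mul_sum]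
  · congr 1
    exact Finset.sum_congr rfl fun T hT => Finset.prod_insert (hnot T hT)
  · intro T hT T' hT' h
    rw [← Finset.erase_insert (hnot T hT), ← Finset.erase_insert (hnot T' hT')]
    exact congrArg (fun U => U.erase j) h
  · rw [Finset.disjoint_left]
    intro T hT hT'
    obtain ⟨U, _, rfl⟩ := Finset.mem_image.1 hT'
    exact hj ((Finset.mem_powersetCard.1 hT).1 (Finset.mem_insert_self _ _))

theorem esymmOn_succ_of_mem (m : ℕ) {S : Finset (Fin n)} {j : Fin n} (hj : j ∈ S) :
    esymmOn (m + 1) S =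
      esymmOn (m + 1) (S.erase j) + MvPolynomial.X j * esymmOn m (S.erase j) := by
  conv_lhs => rw [← Finset.insert_erase hj]
  exact esymmOn_succ_insert m (Finset.notMem_erase j S)

/-- Each squarefree monomial of degree m+1 arises once for every choice of a among its m+1
variables. -/
theorem sum_X_mul_esymmOn_erase (m : ℕ) (S : Finset (Fin n)) :
    ∑ a ∈ S, MvPolynomial.X a * esymmOn m (S.erase a) = (m + 1 : ℕ) * esymmOn (m + 1) S := by
  induction S using Finset.induction_on generalizing m with
  | empty =>
    have : (∅ : Finset (Fin n)).powersetCard (m + 1) = ∅ :=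
      Finset.powersetCard_eq_empty.2 (Nat.succ_pos m)
    simp [esymmOn, this]
  | insert j S hj ih =>
    rw [Finset.sum_insert hj, Finset.erase_insert hj, esymmOn_succ_insert m hj]
    cases m with
    | zero =>
      have := ih 0
      simp only [esymmOn_zero] at this ⊢
      rw [this]
      push_cast
      ring
    | succ m =>
      have h : ∀ a ∈ S, MvPolynomial.X a * esymmOn (m + 1) ((insert j S).erase a) =
          MvPolynomial.X a * esymmOn (m + 1) (S.erase a) +
            MvPolynomial.X j * (MvPolynomial.X a * esymmOn m (S.erase a)) := by
        intro a ha
        have hja : j ≠ a := fun h => hj (h ▸ ha)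
        rw [Finset.erase_insert_of_ne hja,
          esymmOn_succ_insert m (fun h => hj (Finset.mem_of_mem_erase h))]
        ring
      rw [Finset.sum_congr rfl h, Finset.sum_add_distrib, ← Finset.mul_sum, ih, ih]
      push_cast
      ring

theorem esymmOn_ne_zero {m : ℕ} {S : Finset (Fin n)} (h : m ≤ S.card) : esymmOn m S ≠ 0 := by
  intro h0
  have h1 := congrArg (MvPolynomial.eval fun _ => (1 : ℝ)) h0
  simp only [esymmOn, map_sum, map_prod, MvPolynomial.eval_X, Finset.prod_const_one,
    Finset.sum_const, Finset.card_powersetCard, map_zero, nsmul_eq_mul, mul_one,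
    Nat.cast_eq_zero] at h1
  exact (Nat.choose_pos h).ne' h1

theorem pderiv_esymmOn_of_notMem (m : ℕ) {S : Finset (Fin n)} {j : Fin n} (hj : j ∉ S) :
    MvPolynomial.pderiv j (esymmOn m S) = 0 := by
  rw [esymmOn, map_sum]
  refine Finset.sum_eq_zero fun T hT => ?_
  refine MvPolynomial.pderiv_eq_zero_of_notMem_vars fun h => ?_
  obtain ⟨i, hi, hji⟩ := Finset.mem_biUnion.1 (MvPolynomial.vars_prod _ h)
  rw [MvPolynomial.vars_X, Finset.mem_singleton] at hji
  exact hj (hji ▸ (Finset.mem_powersetCard.1 hT).1 hi)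

theorem pderiv_esymmOn_of_mem (m : ℕ) {S : Finset (Fin n)} {j : Fin n} (hj : j ∈ S) :
    MvPolynomial.pderiv j (esymmOn (m + 1) S) = esymmOn m (S.erase j) := by
  have hj' := Finset.notMem_erase j S
  rw [esymmOn_succ_of_mem m hj, map_add, Derivation.leibniz, pderiv_esymmOn_of_notMem _ hj',
    pderiv_esymmOn_of_notMem _ hj', MvPolynomial.pderiv_X_self]
  simp

/-- Since e_m is affine in each variable, every derivative lowers the degree by one and deletes its
variable. -/
theorem partialSet_esymm {k : ℕ} (S : Finset (Fin n)) (hS : S.card ≤ k) :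
    partialSet S (MvPolynomial.esymm (Fin n) ℝ k) = esymmOn (k - S.card) Sᶜ := by
  induction S using Finset.induction_on with
  | empty =>
    have hp : partialSet (∅ : Finset (Fin n)) = 1 := Finset.noncommProd_empty _ _
    simp [hp, esymmOn_univ]
  | insert j S hj ih =>
    rw [Finset.card_insert_of_notMem hj] at hS ⊢
    have hp : partialSet (insert j S) = ((MvPolynomial.pderiv j :
        Derivation ℝ (MvPolynomial (Fin n) ℝ) _) : Module.End ℝ (MvPolynomial (Fin n) ℝ)) *
          partialSet S := Finset.noncommProd_insert_of_notMem _ _ _ _ hj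
    rw [hp, Module.End.mul_apply, ih (by omega),
      show k - S.card = (k - (S.card + 1)) + 1 by omega, Finset.compl_insert]
    exact pderiv_esymmOn_of_mem _ (Finset.mem_compl.2 hj)

end ElementarySymmetric

/-! ### Elimination on a rooted forest. -/

section RootedForest

variable {W : Type*} [Fintype W] [DecidableEq W] {K : Type*} [Field K]

/-- The reduced Laplacian of a rooted forest, in which every vertex `u` is moreover joined to the
removed vertex with weight `t u`: if `c` and `D = x + c` satisfy the series-parallel recursion, then
the determinant is the product of the pivots `D`. -/
theorem det_reducedLaplacian_of_forest (w : W → Option W → K) (child : W → W → Prop)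
    [DecidableRel child] (d : W → ℕ) (x t c D : W → K)
    (hw : ∀ u v, w u (some v) =
      (if child u v then x v else 0) + (if child v u then x u else 0))
    (hwt : ∀ u, w u none = t u)
    (hd : ∀ u v, child u v → d u < d v)
    (hparent : ∀ u u' v, child u v → child u' v → u = u')
    (hx : ∀ v, (∃ u, child u v) ∨ x v = 0)
    (hD : ∀ v, D v = x v + c v) (hD0 : ∀ v, D v ≠ 0)
    (hc : ∀ u, c u = t u + ∑ v with child u v, x v * c v / D v) :
    (reducedLaplacian w).det = ∏ v, D v := by
  have hirr : ∀ u, ¬ child u u := fun u h => lt_irrefl _ (hd u u h)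
  set N : Matrix W W K := Matrix.of fun u v => if child u v then x v / D v else 0 with hN
  have hdet : (1 - N).transpose.det = 1 := by
    refine Matrix.det_eq_one_of_rank _ d (fun v => by simp [hN, hirr]) fun u v huv hne => ?_
    refine hd v u ?_
    by_contra h
    simp [hN, h, Matrix.one_apply_ne' huv] at hne
  -- Elimination from the leaves as a symmetric factorization; 1 - N is unitriangular for the depth.
  -- Off the diagonal there is no fill-in because parents are unique.
  have hmul : reducedLaplacian w = (1 - N) * Matrix.diagonal D * (1 - N).transpose := by
    ext u u'
    have hentry : ((1 - N) * Matrix.diagonal D * (1 - N).transpose) u u' =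
        (if u = u' then D u else 0) - (if child u u' then x u' else 0) -
          (if child u' u then x u else 0) + ∑ v, N u v * D v * N u' v := by
      have hN1 : ∀ a b, N a b * D b = if child a b then x b else 0 := fun a b => by
        simp only [hN, Matrix.of_apply]
        split_ifs
        · rw [div_mul_cancel₀ _ (hD0 b)]
        · rw [zero_mul]
      rw [← hN1 u u', ← hN1 u' u, Matrix.mul_apply]
      simp only [Matrix.mul_diagonal, Matrix.transpose_apply, Matrix.sub_apply, Matrix.one_apply]
      have : ∀ v, ((if u = v then (1 : K) else 0) - N u v) * D v *
          ((if u' = v then 1 else 0) - N u' v) =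
          (if u = v then (D v * (if u' = v then 1 else 0) - N u' v * D v) else 0) -
            (if u' = v then N u v * D v else 0) + N u v * D v * N u' v := by
        intro v
        split_ifs <;> ring
      simp only [this, Finset.sum_add_distrib, Finset.sum_sub_distrib, Finset.sum_ite_eq,
        Finset.mem_univ, if_true]
      congr 1
      by_cases h : u = u'
      · subst h
        simp
      · simp [h, Ne.symm h]
        ring
    rw [hentry]
    simp only [reducedLaplacian, Matrix.of_apply]
    by_cases huu : u = u'
    · subst huu
      have hsum : ∑ v, N u v * D v * N u v = ∑ v with child u v, x v * x v / D v := by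
        rw [Finset.sum_filter]
        refine Finset.sum_congr rfl fun v _ => ?_
        simp only [hN, Matrix.of_apply]
        have := hD0 v
        split_ifs
        · field_simp
        · simp
      have hup : ∑ v, (if child v u then x u else 0) = x u := by
        rcases hx u with ⟨p, hp⟩ | h0
        · rw [Finset.sum_eq_single p, if_pos hp]
          · intro b _ hb
            rw [if_neg fun h => hb (hparent _ _ _ h hp)]
          · simp
        · simp [h0]
      have hc' := hc u
      -- From D = x + c: xc/D = x - x²/D, the series conductance as the Schur complement correction.
      have hsplit : ∑ v with child u v, x v * c v / D v =
          ∑ v with child u v, x v - ∑ v with child u v, x v * x v / D v := by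
        rw [← Finset.sum_sub_distrib]
        refine Finset.sum_congr rfl fun v _ => ?_
        have := hD0 v
        rw [eq_sub_iff_add_eq, ← add_div, div_eq_iff this, hD]
        ring
      simp only [if_true, Fintype.sum_option, hw, hwt, Finset.sum_add_distrib, hup, hirr, if_false,
        hsum, hD u, hc', hsplit, Finset.sum_filter]
      ring
    · have hsum : ∑ v, N u v * D v * N u' v = 0 := by
        refine Finset.sum_eq_zero fun v _ => ?_
        simp only [hN, Matrix.of_apply]
        by_cases h1 : child u v
        · have h2 : ¬ child u' v := fun h2 => huu (hparent _ _ _ h1 h2)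
          simp [h2]
        · simp [h1]
      rw [hsum, if_neg huu, if_neg huu, hw]
      ring
  rw [hmul, Matrix.det_mul, Matrix.det_mul, Matrix.det_diagonal, hdet,
    ← Matrix.det_transpose (1 - N), hdet]
  ring

end RootedForest

/-! ### The tree of words and its counts. -/

section Words

variable {n k : ℕ}

/-- `v` is the word `u` followed by one letter. -/
def IsExtension (u v : DWord n k) : Prop := ∃ a, v.1 = u.1 ++ [a]

theorem IsExtension.length {u v : DWord n k} (h : IsExtension u v) :
    v.1.length = u.1.length + 1 := by
  obtain ⟨a, h⟩ := h
  simp [h]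

theorem IsExtension.left_unique {u u' v : DWord n k} (h : IsExtension u v)
    (h' : IsExtension u' v) : u = u' := by
  obtain ⟨a, h⟩ := h
  obtain ⟨b, h'⟩ := h'
  exact Subtype.ext (List.append_inj_left' (h.symm.trans h') rfl)

theorem exists_isExtension {v : DWord n k} (hv : v.1 ≠ []) : ∃ u, IsExtension u v :=
  ⟨⟨v.1.dropLast, v.2.1.sublist (List.dropLast_sublist _),
    (List.dropLast_sublist _).length_le.trans v.2.2⟩, v.1.getLast hv,
    (List.dropLast_append_getLast hv).symm⟩

theorem card_toFinset_dWord (v : DWord n k) : v.1.toFinset.card = v.1.length :=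
  List.toFinset_card_of_nodup v.2.1

open Classical in
theorem sum_extensions {M : Type*} [AddCommMonoid M] (u : DWord n k) (hu : u.1.length < k)
    (f : List (Fin n) → M) :
    ∑ v with IsExtension u v, f v.1 = ∑ a ∈ (u.1.toFinset)ᶜ, f (u.1 ++ [a]) := by
  symm
  have hmem : ∀ a ∈ (u.1.toFinset)ᶜ, a ∉ u.1 := fun a ha h =>
    Finset.mem_compl.1 ha (List.mem_toFinset.2 h)
  have hnd : ∀ a ∈ (u.1.toFinset)ᶜ, (u.1 ++ [a]).Nodup ∧ (u.1 ++ [a]).length ≤ k := by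
    intro a ha
    refine ⟨List.nodup_append.2 ⟨u.2.1, List.nodup_singleton a, ?_⟩, ?_⟩
    · rintro x hx y hy rfl
      rw [List.mem_singleton] at hy
      exact hmem a ha (hy ▸ hx)
    · rw [List.length_append]
      exact hu
  refine Finset.sum_bij (fun a ha => ⟨u.1 ++ [a], hnd a ha⟩) ?_ ?_ ?_ ?_
  · intro a ha
    exact Finset.mem_filter.2 ⟨Finset.mem_univ _, a, rfl⟩
  · intro a _ b _ h
    simpa using congrArg Subtype.val h
  · intro v hv
    obtain ⟨a, ha⟩ := (Finset.mem_filter.1 hv).2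
    refine ⟨a, ?_, Subtype.ext ha.symm⟩
    rw [Finset.mem_compl, List.mem_toFinset]
    intro h
    have := v.2.1
    rw [ha, List.nodup_append] at this
    exact this.2.2 a h a (List.mem_singleton_self a) rfl
  · intro a _
    rfl

open Classical in
theorem card_extensions (u : DWord n k) :
    (Finset.univ.filter (IsExtension u)).card =
      if u.1.length < k then n - u.1.length else 0 := by
  split_ifs with h
  · rw [Finset.card_eq_sum_ones, sum_extensions u h fun _ => 1, ← Finset.card_eq_sum_ones,
      Finset.card_compl, Fintype.card_fin, card_toFinset_dWord]
  · refine Finset.card_eq_zero.2 (Finset.filter_eq_empty_iff.2 fun v _ hv => h ?_)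
    have := v.2.2
    rw [hv.length] at this
    exact this

open Classical in
theorem card_dWord_toFinset_eq (S : Finset (Fin n)) (hS : S.card < k) :
    (Finset.univ.filter fun u : DWord n k => u.1.length < k ∧ u.1.toFinset = S).card =
      S.card ! := by
  rw [← Finset.length_toList S, ← List.length_permutations,
    ← List.toFinset_card_of_nodup (List.nodup_permutations _ S.nodup_toList)]
  refine Finset.card_bij (fun u _ => u.1) ?_ ?_ ?_
  · intro u hu
    have hu' := (Finset.mem_filter.1 hu).2.2
    rw [List.mem_toFinset, List.mem_permutations, List.perm_ext_iff_of_nodup u.2.1 S.nodup_toList]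
    intro a
    rw [Finset.mem_toList, ← hu', List.mem_toFinset]
  · intro u _ v _ h
    exact Subtype.ext h
  · intro l hl
    rw [List.mem_toFinset, List.mem_permutations] at hl
    have hlen : l.length < k := by
      rw [hl.length_eq, Finset.length_toList]
      exact hS
    refine ⟨⟨l, hl.nodup_iff.2 S.nodup_toList, hlen.le⟩, ?_, rfl⟩
    refine Finset.mem_filter.2 ⟨Finset.mem_univ _, hlen, ?_⟩
    rw [List.toFinset_eq_of_perm _ _ hl, Finset.toList_toFinset]

-- Groups the words by their set of letters; each S is spelled by |S|! words.
open Classical in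
theorem prod_dWord_toFinset {M : Type*} [CommMonoid M] (g : Finset (Fin n) → M) :
    ∏ u : DWord n k with u.1.length < k, g u.1.toFinset =
      ∏ S : Finset (Fin n) with S.card < k, g S ^ (S.card !) := by
  rw [← Finset.prod_fiberwise_of_maps_to' (t := Finset.univ.filter fun S => S.card < k)
    (g := fun u : DWord n k => u.1.toFinset)]
  · refine Finset.prod_congr rfl fun S hS => ?_
    rw [Finset.prod_const, Finset.filter_filter,
      card_dWord_toFinset_eq S (Finset.mem_filter.1 hS).2]
  · intro u hu
    refine Finset.mem_filter.2 ⟨Finset.mem_univ _, ?_⟩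
    rw [card_toFinset_dWord]
    exact (Finset.mem_filter.1 hu).2

end Words

noncomputable section

/-! ### Conductances, pivots and their product. -/

section Evaluation

variable {n k : ℕ}

/-- The elementary symmetric polynomial `e_j(S)`, as a rational function. -/
def esymmRat (j : ℕ) (S : Finset (Fin n)) : RatFun n :=
  algebraMap (MvPolynomial (Fin n) ℝ) (RatFun n) (esymmOn j S)

theorem esymmRat_ne_zero {m : ℕ} {S : Finset (Fin n)} (h : m ≤ S.card) : esymmRat m S ≠ 0 :=
  fun h0 => esymmOn_ne_zero h (IsFractionRing.injective (MvPolynomial (Fin n) ℝ) (RatFun n)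
    (h0.trans (map_zero _).symm))

theorem card_compl_toFinset_dWord (v : DWord n k) : (v.1.toFinset)ᶜ.card = n - v.1.length := by
  rw [Finset.card_compl, Fintype.card_fin, card_toFinset_dWord]

/-- The effective conductance `(k - |v| + 1)! q_{k-|v|+1}([n] \ v)` between `v` and `z` below `v`. -/
def conductance (k : ℕ) (v : List (Fin n)) : RatFun n :=
  ((k - v.length + 1)! : RatFun n) * qRat (k - v.length + 1) (v.toFinset)ᶜ

/-- The total conductance at `v` after elimination of the words that extend `v`. -/
def pivot (k : ℕ) (v : List (Fin n)) : RatFun n :=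
  ((k - v.length + 1)! : RatFun n) * (esymmRat (k - v.length + 1) (v.dropLast.toFinset)ᶜ /
    esymmRat (k - v.length) (v.toFinset)ᶜ)

theorem conductance_eq (v : List (Fin n)) : conductance k v =
    ((k - v.length + 1)! : RatFun n) * (esymmRat (k - v.length + 1) (v.toFinset)ᶜ /
      esymmRat (k - v.length) (v.toFinset)ᶜ) := rfl

theorem letterVar_append (u : List (Fin n)) (a : Fin n) :
    letterVar k (u ++ [a]) = ((k - (u.length + 1) + 1)! : RatFun n) *
      algebraMap (MvPolynomial (Fin n) ℝ) (RatFun n) (MvPolynomial.X a) := by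
  simp [letterVar]

theorem compl_toFinset_append (u : List (Fin n)) (a : Fin n) :
    ((u ++ [a]).toFinset)ᶜ = (u.toFinset)ᶜ.erase a := by
  ext b
  simp

theorem esymmRat_succ_of_mem (m : ℕ) {S : Finset (Fin n)} {a : Fin n} (ha : a ∈ S) :
    esymmRat (m + 1) S = esymmRat (m + 1) (S.erase a) +
      algebraMap (MvPolynomial (Fin n) ℝ) (RatFun n) (MvPolynomial.X a) *
        esymmRat m (S.erase a) := by
  simp only [esymmRat, esymmOn_succ_of_mem m ha, map_add, map_mul]

theorem sum_X_mul_esymmRat_erase (m : ℕ) (S : Finset (Fin n)) :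
    ∑ a ∈ S, algebraMap (MvPolynomial (Fin n) ℝ) (RatFun n) (MvPolynomial.X a) *
      esymmRat m (S.erase a) = (m + 1 : ℕ) * esymmRat (m + 1) S := by
  have := congrArg (algebraMap (MvPolynomial (Fin n) ℝ) (RatFun n)) (sum_X_mul_esymmOn_erase m S)
  simpa only [esymmRat, map_sum, map_mul, map_natCast] using this

theorem esymmRat_dWord_ne_zero (hkn : k ≤ n - 1) (v : DWord n k) :
    esymmRat (k - v.1.length) (v.1.toFinset)ᶜ ≠ 0 :=
  esymmRat_ne_zero (by rw [card_compl_toFinset_dWord]; omega)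

theorem pivot_append (u : List (Fin n)) (a : Fin n) : pivot k (u ++ [a]) =
    ((k - (u.length + 1) + 1)! : RatFun n) * (esymmRat (k - (u.length + 1) + 1) (u.toFinset)ᶜ /
      esymmRat (k - (u.length + 1)) ((u.toFinset)ᶜ.erase a)) := by
  rw [pivot, List.dropLast_concat, compl_toFinset_append, List.length_append,
    List.length_singleton]

theorem conductance_append (u : List (Fin n)) (a : Fin n) : conductance k (u ++ [a]) =
    ((k - (u.length + 1) + 1)! : RatFun n) *
      (esymmRat (k - (u.length + 1) + 1) ((u.toFinset)ᶜ.erase a) /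
        esymmRat (k - (u.length + 1)) ((u.toFinset)ᶜ.erase a)) := by
  rw [conductance_eq, compl_toFinset_append, List.length_append, List.length_singleton]

/-- For a nonempty word this is the deletion recursion for e_m at the last letter. At the empty word
`letterVar` is 0 and `dropLast` changes nothing, so both sides are c_s. -/
theorem pivot_eq_add (hkn : k ≤ n - 1) (v : DWord n k) :
    pivot k v.1 = letterVar k v.1 + conductance k v.1 := by
  rcases List.eq_nil_or_concat v.1 with h | ⟨u, a, h⟩
  · rw [h, conductance_eq, pivot]
    simp [letterVar]
  · have hE := esymmRat_dWord_ne_zero hkn v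
    have ha : a ∈ (u.toFinset)ᶜ := by
      have := v.2.1
      rw [h, List.concat_eq_append, List.nodup_append] at this
      rw [Finset.mem_compl, List.mem_toFinset]
      exact fun hm => this.2.2 a hm a (List.mem_singleton_self a) rfl
    rw [List.concat_eq_append] at h
    rw [h, compl_toFinset_append, List.length_append, List.length_singleton] at hE
    rw [h, pivot_append, conductance_append, letterVar_append, esymmRat_succ_of_mem _ ha]
    field_simp
    ring

/-- The tight case is the empty word, whose numerator e_{k+1}([n]) is nonzero because k + 1 ≤ n. -/
theorem pivot_ne_zero (hkn : k ≤ n - 1) (hn : 1 ≤ n) (v : DWord n k) : pivot k v.1 ≠ 0 := by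
  refine mul_ne_zero (Nat.cast_ne_zero.2 (Nat.factorial_ne_zero _))
    (div_ne_zero (esymmRat_ne_zero ?_) (esymmRat_dWord_ne_zero hkn v))
  have h1 : (v.1.dropLast.toFinset)ᶜ.card = n - (v.1.length - 1) := by
    rw [Finset.card_compl, Fintype.card_fin, List.toFinset_card_of_nodup
      (v.2.1.sublist (List.dropLast_sublist _)), List.length_dropLast]
  have := v.2.2
  rw [h1]
  omega

/-- The denominators e_{m-1}(S \ a) cancel, leaving e_m(S), which does not depend on a; so the sum
over the children can be evaluated. -/
theorem conductance_series {u : List (Fin n)} {a : Fin n}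
    (hu : u.length < k) (hE : esymmRat (k - u.length) (u.toFinset)ᶜ ≠ 0)
    (hEa : esymmRat (k - (u.length + 1)) ((u.toFinset)ᶜ.erase a) ≠ 0) :
    letterVar k (u ++ [a]) * conductance k (u ++ [a]) / pivot k (u ++ [a]) =
      ((k - u.length)! : RatFun n) / esymmRat (k - u.length) (u.toFinset)ᶜ *
        (algebraMap (MvPolynomial (Fin n) ℝ) (RatFun n) (MvPolynomial.X a) *
          esymmRat (k - u.length) ((u.toFinset)ᶜ.erase a)) := by
  have hf : ((k - u.length)! : RatFun n) ≠ 0 := Nat.cast_ne_zero.2 (Nat.factorial_ne_zero _)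
  rw [letterVar_append, conductance_append, pivot_append,
    show k - (u.length + 1) + 1 = k - u.length by omega]
  field_simp

open Classical in
theorem conductance_eq_sum (hkn : k ≤ n - 1) (hn : 1 ≤ n) (u : DWord n k) :
    conductance k u.1 = (if u.1.length = k then terminalVar k k u.1 else 0) +
      ∑ v with IsExtension u v, letterVar k v.1 * conductance k v.1 / pivot k v.1 := by
  split_ifs with h
  · rw [show (Finset.univ.filter (IsExtension u)) = ∅ from
      Finset.card_eq_zero.1 (by rw [card_extensions, if_neg h.not_lt]), Finset.sum_empty, add_zero,
      conductance, terminalVar, h]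
  · have hu : u.1.length < k := lt_of_le_of_ne u.2.2 h
    rw [sum_extensions u hu fun v => letterVar k v * conductance k v / pivot k v, zero_add]
    rw [Finset.sum_congr rfl fun a ha => conductance_series hu (esymmRat_dWord_ne_zero hkn u)
      (esymmRat_ne_zero (by
        rw [Finset.card_erase_of_mem ha, card_compl_toFinset_dWord]; omega)),
      ← Finset.mul_sum, sum_X_mul_esymmRat_erase, conductance_eq, Nat.factorial_succ]
    push_cast
    ring

theorem GGraph_adj_some {u v : DWord n k} :
    (GGraph n k).Adj (some u) (some v) ↔ IsExtension u v ∨ IsExtension v u := Iff.rfl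

theorem not_isExtension_swap {u v : DWord n k} (h : IsExtension u v) : ¬ IsExtension v u := by
  intro h'
  have := h.length
  have := h'.length
  omega

theorem HRat_eq_prod_pivot (hkn : k ≤ n - 1) (hn : 1 ≤ n) :
    HRat n k k = ∏ v : DWord n k, pivot k v.1 := by
  classical
  rw [HRat, aeval_spanningTreePolynomial_eq_det (GGraph n k) (edgeValue n k k)
    (fun v o => if (GGraph n k).Adj (some v) o then endpointVar n k k (some v) o else 0)
    (fun v o h => if_pos h) (fun v o h => if_neg h)]
  refine det_reducedLaplacian_of_forest _ IsExtension (fun v => v.1.length)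
    (fun v => letterVar k v.1) (fun u => if u.1.length = k then terminalVar k k u.1 else 0)
    (fun v => conductance k v.1) _ ?_ ?_ ?_ ?_ ?_ (pivot_eq_add hkn) (pivot_ne_zero hkn hn)
    (conductance_eq_sum hkn hn)
  · intro u v
    simp only [GGraph_adj_some, endpointVar]
    by_cases h : IsExtension u v
    · have := h.length
      rw [if_pos (Or.inl h), if_pos h, if_neg (not_isExtension_swap h), if_pos (by omega), add_zero]
    · by_cases h' : IsExtension v u
      · have := h'.length
        rw [if_pos (Or.inr h'), if_neg h, if_pos h', if_neg (by omega), if_pos (by omega), zero_add]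
      · rw [if_neg (by tauto), if_neg h, if_neg h', add_zero]
  · intro u
    exact if_congr Iff.rfl rfl rfl
  · intro u v h
    have := h.length
    omega
  · intro u u' v h h'
    exact h.left_unique h'
  · intro v
    by_cases hv : v.1 = []
    · exact Or.inr (by simp [hv, letterVar])
    · exact Or.inl (exists_isExtension hv)

-- The numerator at a nonempty word depends only on its parent, so it is collected once per child;
-- one of the n-|u| copies is split off to cancel the denominator at u.
open Classical in
theorem prod_esymmRat_dropLast (hk : 1 ≤ k) (hkn : k ≤ n - 1) :
    ∏ v : DWord n k, esymmRat (k - v.1.length + 1) (v.1.dropLast.toFinset)ᶜ =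
      esymmRat (k + 1) Finset.univ * ((∏ v : DWord n k, esymmRat (k - v.1.length) (v.1.toFinset)ᶜ) *
        ∏ u : DWord n k with u.1.length < k,
          esymmRat (k - u.1.toFinset.card) (u.1.toFinset)ᶜ ^ (n - u.1.toFinset.card - 1)) := by
  -- The parent is selected by an indicator over all u, so that the two products can be
  -- interchanged.
  have hfac : ∀ v : DWord n k, esymmRat (k - v.1.length + 1) (v.1.dropLast.toFinset)ᶜ =
      (if v = ⟨[], List.nodup_nil, Nat.zero_le _⟩ then esymmRat (k + 1) Finset.univ else 1) *
        ∏ u : DWord n k, if IsExtension u v then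
          esymmRat (k - u.1.length) (u.1.toFinset)ᶜ else 1 := by
    intro v
    by_cases hv : v.1 = []
    · have hv' : v = ⟨[], List.nodup_nil, Nat.zero_le _⟩ := Subtype.ext hv
      have hno : ∀ u : DWord n k, ¬ IsExtension u v := fun u h => by
        have := h.length
        simp [hv] at this
      simp [hno, hv, if_pos hv']
    · obtain ⟨u, hu⟩ := exists_isExtension hv
      rw [if_neg fun h => hv (congrArg Subtype.val h), one_mul,
        Finset.prod_eq_single u (fun u' _ hne => if_neg fun h => hne (h.left_unique hu)) (by simp),
        if_pos hu]
      have hlen := hu.length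
      have hvk := v.2.2
      obtain ⟨a, ha⟩ := hu
      rw [show k - v.1.length + 1 = k - u.1.length by omega, ha, List.dropLast_concat]
  rw [Finset.prod_congr rfl fun v _ => hfac v, Finset.prod_mul_distrib, Finset.prod_comm,
    Finset.prod_ite_eq' Finset.univ, if_pos (Finset.mem_univ _), Finset.prod_filter,
    ← Finset.prod_mul_distrib]
  congr 1
  refine Finset.prod_congr rfl fun u _ => ?_
  rw [← Finset.prod_filter, Finset.prod_const, card_extensions, card_toFinset_dWord]
  split_ifs with h
  · rw [← pow_succ', show n - u.1.length - 1 + 1 = n - u.1.length by omega]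
  -- A word of length k has no children, and its denominator is e_0 = 1.
  · rw [show k - u.1.length = 0 by omega]
    simp [esymmRat]

open Classical in
theorem prod_pivot (hk : 1 ≤ k) (hkn : k ≤ n - 1) :
    ∏ v : DWord n k, pivot k v.1 =
      ((∏ v : DWord n k, (k - v.1.length + 1)! : ℕ) : RatFun n) * esymmRat (k + 1) Finset.univ *
        ∏ S : Finset (Fin n) with S.card < k,
          esymmRat (k - S.card) Sᶜ ^ (S.card ! * (n - S.card - 1)) := by
  have hE : ∏ v : DWord n k, esymmRat (k - v.1.length) (v.1.toFinset)ᶜ ≠ 0 :=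
    Finset.prod_ne_zero_iff.2 fun v _ => esymmRat_dWord_ne_zero hkn v
  simp only [pivot, Finset.prod_mul_distrib, Finset.prod_div_distrib]
  rw [prod_esymmRat_dropLast hk hkn, prod_dWord_toFinset fun S =>
    esymmRat (k - S.card) Sᶜ ^ (n - S.card - 1), Nat.cast_prod]
  have hpow : ∀ S : Finset (Fin n), (esymmRat (k - S.card) Sᶜ ^ (n - S.card - 1)) ^ S.card ! =
      esymmRat (k - S.card) Sᶜ ^ (S.card ! * (n - S.card - 1)) := fun S => by
    rw [← pow_mul, mul_comm]
  simp only [hpow]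
  field_simp

/-- At r = k the terminal value is 1! e_1 / e_0 = e_1, the only place where a quotient could occur.
-/
theorem exists_isHomogeneous_edgeValue (e : (GGraph n k).edgeSet) :
    ∃ L : MvPolynomial (Fin n) ℝ, L.IsHomogeneous 1 ∧
      algebraMap (MvPolynomial (Fin n) ℝ) (RatFun n) L = edgeValue n k k e := by
  have hletter : ∀ v : List (Fin n), ∃ L : MvPolynomial (Fin n) ℝ, L.IsHomogeneous 1 ∧
      algebraMap (MvPolynomial (Fin n) ℝ) (RatFun n) L = letterVar k v := by
    intro v
    rcases List.eq_nil_or_concat v with rfl | ⟨u, a, rfl⟩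
    · exact ⟨0, MvPolynomial.isHomogeneous_zero _ _ _, by simp [letterVar]⟩
    · refine ⟨MvPolynomial.C ((k - (u.length + 1) + 1)! : ℝ) * MvPolynomial.X a,
        (MvPolynomial.isHomogeneous_X ℝ a).C_mul _, ?_⟩
      rw [List.concat_eq_append, letterVar_append, map_mul, map_natCast, map_natCast]
  have hterminal : ∀ v : List (Fin n), ∃ L : MvPolynomial (Fin n) ℝ, L.IsHomogeneous 1 ∧
      algebraMap (MvPolynomial (Fin n) ℝ) (RatFun n) L = terminalVar k k v := by
    intro v
    refine ⟨∑ i ∈ (v.toFinset)ᶜ, MvPolynomial.X i, MvPolynomial.IsHomogeneous.sum _ _ _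
      fun i _ => MvPolynomial.isHomogeneous_X ℝ i, ?_⟩
    rw [← esymmOn_one]
    simp [terminalVar, qRat]
  obtain ⟨e, he⟩ := e
  induction e using Sym2.ind with
  | _ u v =>
    change ∃ L : MvPolynomial (Fin n) ℝ, L.IsHomogeneous 1 ∧
      algebraMap (MvPolynomial (Fin n) ℝ) (RatFun n) L = endpointVar n k k u v
    rcases u with _ | u <;> rcases v with _ | v <;> simp only [endpointVar]
    · exact ⟨0, MvPolynomial.isHomogeneous_zero _ _ _, map_zero _⟩
    · exact hterminal _
    · exact hterminal _
    · split_ifs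
      · exact hletter _
      · exact hletter _
      · exact ⟨0, MvPolynomial.isHomogeneous_zero _ _ _, map_zero _⟩

end Evaluation

end

theorem lemma2 (n k : ℕ) (hk : 1 ≤ k) (hkn : k ≤ n - 1) :
    (∃ L : (GGraph n k).edgeSet → MvPolynomial (Fin n) ℝ,
      (∀ e, (L e).IsHomogeneous 1 ∧
        algebraMap (MvPolynomial (Fin n) ℝ) (RatFun n) (L e) = edgeValue n k k e) ∧
      HRat n k k = algebraMap (MvPolynomial (Fin n) ℝ) (RatFun n)
        (MvPolynomial.aeval L (spanningTreePolynomial (GGraph n k)))) ∧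
    ∃ C : ℝ, 0 < C ∧
      HRat n k k = algebraMap (MvPolynomial (Fin n) ℝ) (RatFun n)
        (MvPolynomial.C C * MvPolynomial.esymm (Fin n) ℝ (k + 1) *
          ∏ S : Finset (Fin n) with S.card ≤ k - 1,
            (partialSet S (MvPolynomial.esymm (Fin n) ℝ k)) ^ (S.card ! * (n - S.card - 1))) := by
  constructor
  · choose L hL using exists_isHomogeneous_edgeValue (n := n) (k := k)
    refine ⟨L, hL, ?_⟩
    rw [HRat, ← MvPolynomial.aeval_algebraMap_apply]
    exact congrArg (fun x => MvPolynomial.aeval x (spanningTreePolynomial (GGraph n k)))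
      (funext fun e => (hL e).2.symm)
  -- The constant collects the factorial of every pivot, including (k+1)! at the empty word.
  · refine ⟨(∏ v : DWord n k, (k - v.1.length + 1)! : ℕ),
      Nat.cast_pos.2 (Finset.prod_pos fun v _ => Nat.factorial_pos _), ?_⟩
    rw [HRat_eq_prod_pivot hkn (by omega), prod_pivot hk hkn, map_mul, map_mul, map_natCast,
      map_natCast, map_prod]
    congr 1
    refine Finset.prod_congr ?_ fun S hS => ?_
    · ext S
      simp only [Finset.mem_filter, Finset.mem_univ, true_and]
      omega
    · have hS' := (Finset.mem_filter.1 hS).2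
      rw [map_pow, partialSet_esymm S (by omega)]
      rfl
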